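/- Let $n$ be a positive integer, let $c_1,c_2,\ldots,c_n>0$ be real numbers, let $k_1<k_2<\cdots<k_n$ be positive integers, and let $\sum_{N=0}^\infty b_Nw^N$ be the power series expansion around the origin of the function $f(w):=\exp\left(\sum_{i=1}^n c_iw^{k_i}\right)$ of a complex variable $w$. Suppose that $b_N>0$ for all sufficiently large $N$. Then $$\frac{b_{N-1}}{b_N}\sim\left(\frac{N}{c_nk_n}\right)^{1/k_n}\qquad\text{as }N\to\infty,$$ that is, the quotient of the two sides tends to $1$ as $N\to\infty$. -/

import Mathlib

open Filter Asymptotics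

/-!
The proof is the saddle point method, in the probabilistic form of a local limit theorem.

Write `P(w) = ∑ c_i w ^ k_i` and `K` for the largest exponent. For `r > 0` the weights
`b_N r ^ N / exp (P r)` have mean `a(r) = ∑ k_i c_i r ^ k_i` and variance
`σ(r) ^ 2 = ∑ k_i ^ 2 c_i r ^ k_i`. Choose `ρ_N` with `a(ρ_N) = N`. Cauchy's formula on the circle
of radius `r = ρ_N`, with the angle rescaled by `θ = t / σ`, expresses
`2 π σ b_M r ^ M / exp (P r)` as an integral over `|t| ≤ π σ` of
`exp (Λ_r(t / σ) + i (N - M) t / σ)`, where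
`Λ_r(θ) = ∑ c_i r ^ k_i (exp (i k_i θ) - 1 - i k_i θ)`
(`ExpPoly.coeff_mul_stdDev_eq_integral`). As `r → ∞` the integrand tends pointwise to
`exp (-t ^ 2 / 2)` for every fixed `N - M` (`ExpPoly.tendsto_cumulant`), and it is dominated by an
integrable function independent of `r` (`ExpPoly.exists_integrable_bound`):

* for `|θ| ≤ π / K` the leading monomial alone gives decay like `exp (-α t ^ 2)`;
* for `π / K ≤ |θ| ≤ π` the modulus is at most `exp (-κ r)`. This needs that no `ζ ≠ 1` on the unit
  circle satisfies `ζ ^ k_i = 1` for all `i`, and here the eventual positivity of `b_N` enters: such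
  a `ζ` would leave the function invariant under `w ↦ ζ w`, so `b_N ζ ^ N = b_N` for all `N`
  (`ExpPoly.eq_one_of_forall_pow_eq_one`).

By dominated convergence the integrals for `M = N` and `M = N - 1` have the same nonzero limit, so
`b_{N-1} / (b_N ρ_N) → 1`. Finally `a(r) ~ c K r ^ K`, with `c` the leading coefficient, turns
`a(ρ_N) = N` into `ρ_N ~ (N / (c K)) ^ (1 / K)`.
-/

namespace ExpPoly

open Topology MeasureTheory
open scoped Real

variable {ι : Type*} [Fintype ι] {c : ι → ℝ} {k : ι → ℕ}

/-! ### Cauchy's formula in saddle point coordinates -/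

/-- The mean of the weights `b_N r ^ N`, where `∑ b_N w ^ N = exp (∑ c_i w ^ k_i)`; that is,
`r P'(r)` for `P(w) = ∑ c_i w ^ k_i`. -/
noncomputable def mean (c : ι → ℝ) (k : ι → ℕ) (r : ℝ) : ℝ := ∑ i, (k i : ℝ) * (c i * r ^ k i)

/-- The standard deviation of the weights `b_N r ^ N`, where
`∑ b_N w ^ N = exp (∑ c_i w ^ k_i)`. -/
noncomputable def stdDev (c : ι → ℝ) (k : ι → ℕ) (r : ℝ) : ℝ :=
  √(∑ i, (k i : ℝ) ^ 2 * (c i * r ^ k i))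

/-- The logarithm of the centred characteristic function of the weights `b_N r ^ N`, where
`∑ b_N w ^ N = exp P(w)` with `P(w) = ∑ c_i w ^ k_i`; that is,
`P(r exp (i θ)) - P(r) - i θ r P'(r)`. -/
noncomputable def cumulant (c : ι → ℝ) (k : ι → ℕ) (r θ : ℝ) : ℂ :=
  ∑ i, ((c i * r ^ k i : ℝ) : ℂ) *
    (Complex.exp ((k i * θ : ℝ) * Complex.I) - 1 - (k i * θ : ℝ) * Complex.I)

/-- Cauchy's formula for the coefficients of an entire function, as a Fourier integral. -/
theorem coeff_mul_pow_eq_integral {f : ℂ → ℂ} (hf : Differentiable ℂ f) {b : ℕ → ℝ}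
    (hb : HasFPowerSeriesAt f
      (FormalMultilinearSeries.ofScalars ℂ (fun N : ℕ => (b N : ℂ))) 0)
    {r : ℝ} (hr : 0 < r) (N : ℕ) :
    2 * π * ((b N : ℂ) * r ^ N) =
      ∫ θ in -π..π, Complex.exp (-(N * θ : ℝ) * Complex.I) *
        f (r * Complex.exp (θ * Complex.I)) := by
  have h1 : HasFPowerSeriesAt f (cauchyPowerSeries f 0 r) 0 :=
    (hf.hasFPowerSeriesOnBall 0 (R := ⟨r, hr.le⟩) hr).hasFPowerSeriesAt
  have h2 := hb.eq_formalMultilinearSeries h1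
  have h3 := congrArg (fun p : FormalMultilinearSeries ℂ ℂ ℂ => p N (fun _ => (r : ℂ))) h2
  simp only [FormalMultilinearSeries.ofScalars_apply_eq, smul_eq_mul, cauchyPowerSeries_apply,
    circleIntegral] at h3
  rw [h3]
  have hper : Function.Periodic (fun θ : ℝ => Complex.exp (-(N * θ : ℝ) * Complex.I) *
        f (r * Complex.exp (θ * Complex.I))) (2 * π) := by
    intro θ
    have e1 : Complex.exp (((θ + 2 * π : ℝ) : ℂ) * Complex.I) = Complex.exp (θ * Complex.I) := by
      rw [← Complex.exp_periodic (θ * Complex.I)]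
      congr 1; push_cast; ring
    have e2 : ∀ θ : ℝ, Complex.exp (-(N * θ : ℝ) * Complex.I)
        = (Complex.exp (θ * Complex.I))⁻¹ ^ N := by
      intro θ
      rw [← Complex.exp_neg, ← Complex.exp_nat_mul]
      congr 1; push_cast; ring
    simp only [e2, e1]
  have := hper.intervalIntegral_add_eq (-π) 0
  rw [show -π + 2 * π = π by ring, zero_add] at this
  rw [this, ← mul_assoc, ← intervalIntegral.integral_const_mul]
  refine intervalIntegral.integral_congr fun θ _ => ?_
  have hr' : (r : ℂ) ≠ 0 := by exact_mod_cast hr.ne'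
  have e2 : Complex.exp (-(N * θ : ℝ) * Complex.I)
        = (Complex.exp (θ * Complex.I))⁻¹ ^ N := by
    rw [← Complex.exp_neg, ← Complex.exp_nat_mul]
    congr 1; push_cast; ring
  have he := Complex.exp_ne_zero (θ * Complex.I)
  have hI := Complex.I_ne_zero
  have hpi : (π : ℂ) ≠ 0 := by exact_mod_cast Real.pi_ne_zero
  simp only [deriv_circleMap, circleMap, zero_add, sub_zero, e2]
  field_simp

/-- Cauchy's formula for the coefficients of `exp P`, normalised by `exp (P r)` and with the angle
measured in units of `1 / stdDev c k r`. The linear phase vanishes when the mean at `r` is `N`. -/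
theorem coeff_mul_stdDev_eq_integral {b : ℕ → ℝ}
    (hb : HasFPowerSeriesAt (fun w : ℂ => Complex.exp (∑ i, (c i : ℂ) * w ^ k i))
      (FormalMultilinearSeries.ofScalars ℂ (fun N : ℕ => (b N : ℂ))) 0)
    {r : ℝ} (hr : 0 < r) (hσ : 0 < stdDev c k r) (N : ℕ) :
    stdDev c k r * (2 * π * ((b N : ℂ) * r ^ N)) * Complex.exp (-(∑ i, c i * r ^ k i : ℝ)) =
      ∫ t in -(π * stdDev c k r)..(π * stdDev c k r),
        Complex.exp (cumulant c k r (t / stdDev c k r) +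
          ((mean c k r - N) * (t / stdDev c k r) : ℝ) * Complex.I) := by
  rw [coeff_mul_pow_eq_integral (by fun_prop) hb hr]
  have := intervalIntegral.integral_comp_div (a := -(π * stdDev c k r)) (b := π * stdDev c k r)
    (fun θ => Complex.exp (cumulant c k r θ + ((mean c k r - N) * θ : ℝ) * Complex.I)) hσ.ne'
  rw [this, neg_div, mul_div_cancel_right₀ _ hσ.ne', mul_assoc,
    ← intervalIntegral.integral_mul_const, Complex.real_smul]
  congr 1
  refine intervalIntegral.integral_congr fun θ _ => ?_
  rw [← Complex.exp_add, ← Complex.exp_add]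
  congr 1
  have e : ∀ i, (c i : ℂ) * (r * Complex.exp (θ * Complex.I)) ^ k i =
      ((c i * r ^ k i : ℝ) : ℂ) * Complex.exp ((k i * θ : ℝ) * Complex.I) := by
    intro i
    rw [mul_pow, ← Complex.exp_nat_mul]
    push_cast
    ring_nf
  simp only [e, cumulant, mean, mul_sub, Finset.sum_sub_distrib]
  push_cast
  simp only [sub_mul, Finset.sum_mul, mul_one]
  have e3 : ∑ i, (c i : ℂ) * r ^ k i * (k i * θ * Complex.I) =
      ∑ i, k i * (c i * r ^ k i) * θ * Complex.I := Finset.sum_congr rfl fun i _ => by ring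
  rw [e3]
  ring

/-! ### Pointwise convergence to the Gaussian -/

theorem tendsto_stdDev (hc : ∀ i, 0 < c i) (hk : ∀ i, 0 < k i) (j : ι) :
    Tendsto (stdDev c k) atTop atTop := by
  have h1 : Tendsto (fun r : ℝ => (k j : ℝ) ^ 2 * (c j * r ^ k j)) atTop atTop :=
    ((tendsto_pow_atTop (hk j).ne').const_mul_atTop (hc j)).const_mul_atTop
      (by have := hk j; positivity)
  refine Real.tendsto_sqrt_atTop.comp (tendsto_atTop_mono' _ ?_ h1)
  filter_upwards [eventually_ge_atTop 0] with r hr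
  exact Finset.single_le_sum (f := fun i => (k i : ℝ) ^ 2 * (c i * r ^ k i))
    (fun i _ => by have := hc i; positivity) (Finset.mem_univ j)

theorem sq_stdDev (hc : ∀ i, 0 < c i) {r : ℝ} (hr : 0 ≤ r) :
    stdDev c k r ^ 2 = ∑ i, (k i : ℝ) ^ 2 * (c i * r ^ k i) :=
  Real.sq_sqrt (Finset.sum_nonneg fun i _ => by have := hc i; positivity)

theorem norm_exp_sub_taylor_le {x : ℝ} (hx : |x| ≤ 1) :
    ‖Complex.exp (x * Complex.I) - 1 - x * Complex.I + ((x ^ 2 / 2 : ℝ) : ℂ)‖ ≤ |x| ^ 3 := by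
  have h := Complex.exp_bound (x := x * Complex.I) (by simpa using hx) (n := 3) (by norm_num)
  have e : ∑ m ∈ Finset.range 3, (x * Complex.I) ^ m / (m.factorial : ℂ) =
      1 + x * Complex.I - ((x ^ 2 / 2 : ℝ) : ℂ) := by
    simp [Finset.sum_range_succ, mul_pow, Nat.factorial]
    ring
  rw [e] at h
  calc _ = ‖Complex.exp (x * Complex.I) - (1 + x * Complex.I - ((x ^ 2 / 2 : ℝ) : ℂ))‖ := by
        congr 1; ring
    _ ≤ _ := h
    _ ≤ |x| ^ 3 := by
        simp [Nat.factorial]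
        nlinarith [pow_nonneg (abs_nonneg x) 3]

theorem tendsto_cumulant (hc : ∀ i, 0 < c i) (hk : ∀ i, 0 < k i) (top : ι)
    (htop : ∀ i, k i ≤ k top) (t : ℝ) :
    Tendsto (fun r => cumulant c k r (t / stdDev c k r)) atTop (𝓝 ((-(t ^ 2 / 2) : ℝ) : ℂ)) := by
  have hσ := tendsto_stdDev hc hk top
  rw [tendsto_iff_norm_sub_tendsto_zero]
  have hz : Tendsto (fun r => k top * |t| ^ 3 * (stdDev c k r)⁻¹) atTop (𝓝 0) := by
    simpa using (tendsto_inv_atTop_zero.comp hσ).const_mul (k top * |t| ^ 3)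
  refine squeeze_zero' (Eventually.of_forall fun _ => norm_nonneg _) ?_ hz
  filter_upwards [eventually_ge_atTop 0, hσ.eventually_gt_atTop 0,
    hσ.eventually_ge_atTop (k top * |t|)] with r hr hs hs'
  have hsq := sq_stdDev (k := k) hc hr
  set s := stdDev c k r
  have hsmall : ∀ i, |k i * (t / s)| ≤ 1 := by
    intro i
    rw [abs_mul, abs_div, abs_of_pos hs, Nat.abs_cast, ← mul_div_assoc, div_le_one hs]
    refine le_trans ?_ hs'
    have := htop i
    gcongr
  have e : cumulant c k r (t / s) - ((-(t ^ 2 / 2) : ℝ) : ℂ) =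
      ∑ i, ((c i * r ^ k i : ℝ) : ℂ) *
        (Complex.exp ((k i * (t / s) : ℝ) * Complex.I) - 1 - (k i * (t / s) : ℝ) * Complex.I +
          (((k i * (t / s)) ^ 2 / 2 : ℝ) : ℂ)) := by
    have e1 : -(t ^ 2 / 2) = - ∑ i, (c i * r ^ k i) * ((k i * (t / s)) ^ 2 / 2) := by
      have : ∑ i, (c i * r ^ k i) * ((k i * (t / s)) ^ 2 / 2) =
          (∑ i, (k i : ℝ) ^ 2 * (c i * r ^ k i)) * ((t / s) ^ 2 / 2) := by
        rw [Finset.sum_mul]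
        exact Finset.sum_congr rfl fun i _ => by ring
      rw [this, ← hsq]
      field_simp
    rw [e1, cumulant]
    simp only [mul_add, Finset.sum_add_distrib]
    push_cast
    ring
  rw [e]
  refine (norm_sum_le _ _).trans ?_
  calc _ ≤ ∑ i, (c i * r ^ k i) * (k top * (k i : ℝ) ^ 2 * |t / s| ^ 3) := by
        refine Finset.sum_le_sum fun i _ => ?_
        have hci := hc i
        rw [norm_mul, Complex.norm_real, Real.norm_of_nonneg (by positivity)]
        gcongr
        refine (norm_exp_sub_taylor_le (hsmall i)).trans ?_
        rw [abs_mul, Nat.abs_cast, mul_pow, pow_succ' (k i : ℝ)]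
        have := htop i
        gcongr
    _ = (∑ i, (k i : ℝ) ^ 2 * (c i * r ^ k i)) * (k top * |t / s| ^ 3) := by
        rw [Finset.sum_mul]
        exact Finset.sum_congr rfl fun i _ => by ring
    _ = k top * |t| ^ 3 * s⁻¹ := by
        rw [← hsq, abs_div, abs_of_pos hs]
        field_simp

theorem norm_exp_cumulant (r θ m : ℝ) :
    ‖Complex.exp (cumulant c k r θ + (m : ℂ) * Complex.I)‖ =
      Real.exp (-∑ i, c i * r ^ k i * (1 - Real.cos (k i * θ))) := by
  rw [Complex.norm_exp]
  congr 1
  simp only [cumulant, Complex.add_re, Complex.re_sum, Complex.re_ofReal_mul, Complex.sub_re,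
    Complex.exp_ofReal_mul_I_re, Complex.one_re, Complex.I_re, mul_zero, sub_zero, add_zero,
    ← Finset.sum_neg_distrib]
  exact Finset.sum_congr rfl fun i _ => by ring

/-! ### Aperiodicity and domination -/

/-- Aperiodicity: some `ζ ≠ 1` with `ζ ^ k_i = 1` for all `i` would force the coefficients to
vanish outside an arithmetic progression. -/
theorem eq_one_of_forall_pow_eq_one {b : ℕ → ℝ}
    (hb : HasFPowerSeriesAt (fun w : ℂ => Complex.exp (∑ i, (c i : ℂ) * w ^ k i))
      (FormalMultilinearSeries.ofScalars ℂ (fun N : ℕ => (b N : ℂ))) 0)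
    (hb_pos : ∀ᶠ N : ℕ in atTop, 0 < b N) {ζ : ℂ} (hζ : ∀ i, ζ ^ k i = 1) : ζ = 1 := by
  have hinv : ∀ N, ζ ^ N * (b N : ℂ) = b N := by
    have h1 : HasFPowerSeriesAt (fun w : ℂ => Complex.exp (∑ i, (c i : ℂ) * w ^ k i))
        (FormalMultilinearSeries.ofScalars ℂ (fun N : ℕ => ζ ^ N * (b N : ℂ))) 0 := by
      rw [hasFPowerSeriesAt_iff] at hb ⊢
      have ht : Tendsto (fun z : ℂ => ζ * z) (𝓝 0) (𝓝 0) := by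
        simpa using (continuous_const_mul ζ).tendsto 0
      filter_upwards [ht.eventually hb] with z hz
      simp only [FormalMultilinearSeries.coeff_ofScalars, zero_add, smul_eq_mul, mul_pow, hζ,
        one_mul] at hz ⊢
      convert hz using 2
      ring
    intro N
    have := congrArg (fun p : FormalMultilinearSeries ℂ ℂ ℂ => p.coeff N)
      (h1.eq_formalMultilinearSeries hb)
    simpa only [FormalMultilinearSeries.coeff_ofScalars] using this
  obtain ⟨N, hN⟩ := eventually_atTop.1 hb_pos
  have hpow : ∀ M ≥ N, ζ ^ M = 1 := fun M hM =>
    mul_right_cancel₀ (Complex.ofReal_ne_zero.2 (hN M hM).ne') ((hinv M).trans (one_mul _).symm)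
  simpa [pow_succ, hpow N le_rfl] using hpow (N + 1) (Nat.le_succ N)

/-- Away from `θ = 0` the modulus of `exp P` on a circle is uniformly smaller than its value on the
positive axis, by compactness of the remaining arc. -/
theorem exists_pos_le_sum_one_sub_cos (hc : ∀ i, 0 < c i)
    (hap : ∀ ζ : ℂ, (∀ i, ζ ^ k i = 1) → ζ = 1) {δ : ℝ} (hδ : 0 < δ) :
    ∃ κ > 0, ∀ θ : ℝ, δ ≤ |θ| → |θ| ≤ π → κ ≤ ∑ i, c i * (1 - Real.cos (k i * θ)) := by
  have hcomp : IsCompact ({θ : ℝ | δ ≤ |θ|} ∩ Set.Icc (-π) π) :=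
    isCompact_Icc.inter_left (isClosed_le continuous_const continuous_abs)
  have hpos : ∀ θ ∈ ({θ : ℝ | δ ≤ |θ|} ∩ Set.Icc (-π) π),
      0 < ∑ i, c i * (1 - Real.cos (k i * θ)) := by
    rintro θ ⟨h1, h2⟩
    have hnn : ∀ i, 0 ≤ c i * (1 - Real.cos (k i * θ)) := fun i =>
      mul_nonneg (hc i).le (sub_nonneg.2 (Real.cos_le_one _))
    refine (Finset.sum_nonneg fun i _ => hnn i).lt_of_ne' fun h0 => ?_
    have hz : Complex.exp (θ * Complex.I) = 1 := by
      refine hap _ fun i => ?_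
      have hi := (Finset.sum_eq_zero_iff_of_nonneg fun i _ => hnn i).1 h0 i (Finset.mem_univ i)
      have hcos : Real.cos (k i * θ) = 1 := by
        rcases mul_eq_zero.1 hi with h | h
        · exact absurd h (hc i).ne'
        · linarith
      have hsin : Real.sin (k i * θ) = 0 := Real.sin_eq_zero_iff_cos_eq.2 (Or.inl hcos)
      rw [← Complex.exp_nat_mul, ← mul_assoc, ← Complex.ofReal_natCast, ← Complex.ofReal_mul,
        Complex.exp_mul_I, ← Complex.ofReal_cos, ← Complex.ofReal_sin, hcos, hsin]
      simp
    have hcos : Real.cos θ = 1 := by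
      rw [← Complex.exp_ofReal_mul_I_re, hz, Complex.one_re]
    have hθ : θ = 0 := (Real.cos_eq_one_iff_of_lt_of_lt
      (by linarith [h2.1, Real.pi_pos]) (by linarith [h2.2, Real.pi_pos])).1 hcos
    simp only [hθ, Set.mem_ofPred_eq, abs_zero] at h1
    linarith
  obtain ⟨κ, hκ, h⟩ := hcomp.exists_forall_le' (f := fun θ => ∑ i, c i * (1 - Real.cos (k i * θ)))
    (by fun_prop) hpos
  exact ⟨κ, hκ, fun θ h1 h2 => h θ ⟨h1, abs_le.1 h2⟩⟩

theorem sq_stdDev_le (hc : ∀ i, 0 < c i) {top : ι} (htop : ∀ i, k i ≤ k top) {r : ℝ}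
    (hr : 1 ≤ r) : stdDev c k r ^ 2 ≤ (∑ i, (k i : ℝ) ^ 2 * c i) * r ^ k top := by
  rw [sq_stdDev hc (by linarith), Finset.sum_mul]
  refine Finset.sum_le_sum fun i _ => ?_
  have := hc i
  have := htop i
  rw [mul_assoc]
  gcongr

/-- The rescaled integrands are dominated on their range `|t| ≤ π σ` uniformly in `r`. -/
theorem exists_integrable_bound (hc : ∀ i, 0 < c i) (hk : ∀ i, 0 < k i) (top : ι)
    (htop : ∀ i, k i ≤ k top) (hap : ∀ ζ : ℂ, (∀ i, ζ ^ k i = 1) → ζ = 1) :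
    ∃ g : ℝ → ℝ, Integrable g ∧ (∀ t, 0 ≤ g t) ∧ ∀ r, 1 ≤ r → 0 < stdDev c k r →
      ∀ t, |t| ≤ π * stdDev c k r →
        Real.exp (-∑ i, c i * r ^ k i * (1 - Real.cos (k i * (t / stdDev c k r)))) ≤ g t := by
  have hK : (0 : ℝ) < k top := by exact_mod_cast hk top
  have hct := hc top
  obtain ⟨κ, hκ, hcos⟩ := exists_pos_le_sum_one_sub_cos hc hap (div_pos Real.pi_pos hK)
  set D : ℝ := ∑ i, (k i : ℝ) ^ 2 * c i with hD
  have hDpos : 0 < D := Finset.sum_pos (fun i _ => by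
    have := hc i; have := hk i; positivity) ⟨top, Finset.mem_univ _⟩
  set α : ℝ := c top * (2 / π ^ 2) * k top ^ 2 / D
  have hα : 0 < α := by positivity
  set A : ℝ := (1 + π ^ 2 * D) * ((k top).factorial / κ ^ k top)
  have hA : 0 < A := by positivity
  refine ⟨fun t => Real.exp (-α * t ^ 2) + A * (1 + t ^ 2)⁻¹,
    (integrable_exp_neg_mul_sq hα).add (integrable_inv_one_add_sq.const_mul A),
    fun t => by positivity, fun r hr hs t ht => ?_⟩
  have hsD := sq_stdDev_le hc htop hr
  rw [← hD] at hsD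
  set s := stdDev c k r
  have hr0 : 0 < r := by linarith
  have hnn : ∀ i, 0 ≤ c i * r ^ k i * (1 - Real.cos (k i * (t / s))) := fun i =>
    mul_nonneg (by have := hc i; positivity) (sub_nonneg.2 (Real.cos_le_one _))
  have hts : |t / s| = |t| / s := by rw [abs_div, abs_of_pos hs]
  rcases le_total (|t / s|) (π / k top) with h | h
  -- Jordan's inequality `1 - cos x ≥ 2 x² / π²` applies to the leading term, and `r ^ K` has the
  -- order of `σ²`.
  · have h1 : α * t ^ 2 ≤ ∑ i, c i * r ^ k i * (1 - Real.cos (k i * (t / s))) := by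
      refine le_trans ?_ (Finset.single_le_sum (fun i _ => hnn i) (Finset.mem_univ top))
      have hq : 2 / π ^ 2 * (k top * (t / s)) ^ 2 ≤ 1 - Real.cos (k top * (t / s)) := by
        have := Real.cos_le_one_sub_mul_cos_sq (x := k top * (t / s)) (by
          rw [abs_mul, Nat.abs_cast]
          calc _ ≤ k top * (π / k top) := by gcongr
            _ = π := by field_simp)
        linarith
      calc α * t ^ 2 = c top * (2 / π ^ 2) * k top ^ 2 * (t / s) ^ 2 * (s ^ 2 / D) := by
            simp only [α]; field_simp
        _ ≤ c top * (2 / π ^ 2) * k top ^ 2 * (t / s) ^ 2 * r ^ k top := by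
            gcongr
            rw [div_le_iff₀ hDpos]; linarith
        _ = c top * r ^ k top * (2 / π ^ 2 * (k top * (t / s)) ^ 2) := by ring
        _ ≤ _ := by gcongr
    have h2 : (0 : ℝ) ≤ A * (1 + t ^ 2)⁻¹ := by positivity
    have h3 := Real.exp_le_exp.2 (neg_le_neg h1)
    rw [← neg_mul] at h3
    linarith
  -- The decay `exp (-κ r)` beats `1 + t² ≤ const * r ^ K`, the range of `t` being `|t| ≤ π σ`.
  · have h1 : κ * r ≤ ∑ i, c i * r ^ k i * (1 - Real.cos (k i * (t / s))) := by
      have := hcos (t / s) h (by rw [hts, div_le_iff₀ hs]; exact ht)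
      calc κ * r ≤ (∑ i, c i * (1 - Real.cos (k i * (t / s)))) * r := by gcongr
        _ = ∑ i, c i * (1 - Real.cos (k i * (t / s))) * r := Finset.sum_mul _ _ _
        _ ≤ _ := by
          refine Finset.sum_le_sum fun i _ => ?_
          rw [mul_right_comm]
          refine mul_le_mul_of_nonneg_right ?_ (sub_nonneg.2 (Real.cos_le_one _))
          exact mul_le_mul_of_nonneg_left (le_self_pow₀ hr (hk i).ne') (hc i).le
    have h2 : 1 + t ^ 2 ≤ (1 + π ^ 2 * D) * r ^ k top := by
      have ht2 : t ^ 2 ≤ π ^ 2 * s ^ 2 := by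
        rw [← mul_pow, ← sq_abs]; gcongr
      have : 1 ≤ r ^ k top := one_le_pow₀ hr
      nlinarith [mul_le_mul_of_nonneg_left hsD (sq_nonneg π)]
    have h3 : (κ * r) ^ k top / (k top).factorial ≤ Real.exp (κ * r) :=
      Real.pow_div_factorial_le_exp _ (by positivity) _
    have h4 : Real.exp (-(κ * r)) ≤ A * (1 + t ^ 2)⁻¹ := by
      rw [← div_eq_mul_inv, le_div_iff₀ (by positivity)]
      calc Real.exp (-(κ * r)) * (1 + t ^ 2)
          ≤ Real.exp (-(κ * r)) * ((1 + π ^ 2 * D) * r ^ k top) := by gcongr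
        _ = Real.exp (-(κ * r)) * ((κ * r) ^ k top / (k top).factorial) * A := by
            simp only [A, mul_pow]; field_simp
        _ ≤ Real.exp (-(κ * r)) * Real.exp (κ * r) * A := by gcongr
        _ = A := by rw [← Real.exp_add]; simp
    have h5 := Real.exp_le_exp.2 (neg_le_neg h1)
    have h6 := Real.exp_pos (-α * t ^ 2)
    linarith

/-! ### The limit of the integrals -/

/-- The limit does not depend on the shift `m`, the distance from the mean to the index of the
coefficient. -/
theorem tendsto_integral_exp_cumulant (hc : ∀ i, 0 < c i) (hk : ∀ i, 0 < k i) (top : ι)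
    (htop : ∀ i, k i ≤ k top) (hap : ∀ ζ : ℂ, (∀ i, ζ ^ k i = 1) → ζ = 1) (m : ℝ) :
    Tendsto (fun r => ∫ t in -(π * stdDev c k r)..(π * stdDev c k r),
        Complex.exp (cumulant c k r (t / stdDev c k r) +
          (m * (t / stdDev c k r) : ℝ) * Complex.I)) atTop (𝓝 (√(2 * π) : ℝ)) := by
  have hσ := tendsto_stdDev hc hk top
  obtain ⟨g, hg, hg0, hbd⟩ := exists_integrable_bound hc hk top htop hap
  have hlim : ((√(2 * π) : ℝ) : ℂ) = ∫ t : ℝ, ((Real.exp (-(t ^ 2 / 2)) : ℝ) : ℂ) := by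
    rw [integral_complex_ofReal]
    congr 1
    have := integral_gaussian (1 / 2)
    rw [show π / (1 / 2) = 2 * π by ring] at this
    rw [← this]
    congr 1; ext t; congr 1; ring
  rw [hlim]
  have hind : ∀ᶠ r in atTop, ∫ t, (Set.Ioc (-(π * stdDev c k r)) (π * stdDev c k r)).indicator
      (fun t : ℝ => Complex.exp (cumulant c k r (t / stdDev c k r) +
          (m * (t / stdDev c k r) : ℝ) * Complex.I)) t =
      ∫ t in -(π * stdDev c k r)..(π * stdDev c k r),
        Complex.exp (cumulant c k r (t / stdDev c k r) +
          (m * (t / stdDev c k r) : ℝ) * Complex.I) := by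
    filter_upwards [hσ.eventually_gt_atTop 0] with r hr
    have := mul_pos Real.pi_pos hr
    rw [intervalIntegral.integral_of_le (by linarith), integral_indicator measurableSet_Ioc]
  refine Tendsto.congr' hind ?_
  refine tendsto_integral_filter_of_dominated_convergence g ?_ ?_ hg ?_
  · refine Eventually.of_forall fun r => ?_
    refine (Continuous.aestronglyMeasurable ?_).indicator measurableSet_Ioc
    unfold cumulant
    fun_prop
  · filter_upwards [eventually_ge_atTop 1, hσ.eventually_gt_atTop 0] with r hr hs
    refine Eventually.of_forall fun t => ?_
    by_cases ht : t ∈ Set.Ioc (-(π * stdDev c k r)) (π * stdDev c k r)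
    · rw [Set.indicator_of_mem ht, norm_exp_cumulant]
      exact hbd r hr hs t (abs_le.2 ⟨ht.1.le, ht.2⟩)
    · rw [Set.indicator_of_notMem ht, norm_zero]
      exact hg0 t
  · refine Eventually.of_forall fun t => ?_
    have h1 : Tendsto (fun r => Complex.exp (cumulant c k r (t / stdDev c k r) +
          (m * (t / stdDev c k r) : ℝ) * Complex.I)) atTop
        (𝓝 ((Real.exp (-(t ^ 2 / 2)) : ℝ) : ℂ)) := by
      rw [Complex.ofReal_exp]
      refine (Complex.continuous_exp.tendsto _).comp ?_
      have h2 : Tendsto (fun r => ((m * (t / stdDev c k r) : ℝ) : ℂ) * Complex.I) atTop (𝓝 0) := by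
        have h3 : Tendsto (fun r => m * (t / stdDev c k r)) atTop (𝓝 0) := by
          simpa using (hσ.const_div_atTop t).const_mul m
        simpa using ((Complex.continuous_ofReal.tendsto _).comp h3).mul_const Complex.I
      simpa using (tendsto_cumulant hc hk top htop t).add h2
    refine h1.congr' ?_
    have hπ := hσ.const_mul_atTop Real.pi_pos
    filter_upwards [hπ.eventually_gt_atTop |t|] with r hr
    rw [Set.indicator_of_mem]
    exact ⟨(abs_lt.1 hr).1, (abs_lt.1 hr).2.le⟩

/-! ### The saddle point and the ratio of coefficients -/

theorem tendsto_mean_div (hc : ∀ i, 0 < c i) (hk : ∀ i, 0 < k i) (top : ι)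
    (htop : ∀ i ≠ top, k i < k top) :
    Tendsto (fun r => mean c k r / (c top * k top * r ^ k top)) atTop (𝓝 1) := by
  classical
  have hK : (0 : ℝ) < k top := by exact_mod_cast hk top
  have hct := hc top
  have h : ∀ i ∈ Finset.univ, Tendsto
      (fun r : ℝ => (k i : ℝ) * (c i * r ^ k i) / (c top * k top * r ^ k top)) atTop
      (𝓝 (if i = top then 1 else 0)) := by
    intro i _
    split_ifs with hi
    · subst hi
      refine tendsto_const_nhds.congr' ?_
      filter_upwards [eventually_gt_atTop 0] with r hr
      field_simp
    · have := (tendsto_pow_div_pow_atTop_zero (𝕜 := ℝ) (htop i hi)).const_mul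
        ((k i : ℝ) * c i / (c top * k top))
      rw [mul_zero] at this
      refine this.congr fun r => ?_
      rw [div_mul_div_comm, mul_assoc]
  have := tendsto_finsetSum _ h
  simpa [mean, Finset.sum_div] using this

theorem tendsto_mean (hc : ∀ i, 0 < c i) (hk : ∀ i, 0 < k i) (top : ι) :
    Tendsto (mean c k) atTop atTop := by
  have h1 : Tendsto (fun r : ℝ => (k top : ℝ) * (c top * r ^ k top)) atTop atTop :=
    ((tendsto_pow_atTop (hk top).ne').const_mul_atTop (hc top)).const_mul_atTop
      (by exact_mod_cast hk top)
  refine tendsto_atTop_mono' _ ?_ h1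
  filter_upwards [eventually_ge_atTop 0] with r hr
  exact Finset.single_le_sum (f := fun i => (k i : ℝ) * (c i * r ^ k i))
    (fun i _ => by have := hc i; positivity) (Finset.mem_univ top)

/-- The saddle points: radii `ρ N` at which the weights `b_M r ^ M` have mean `N`. -/
theorem exists_saddle (hc : ∀ i, 0 < c i) (hk : ∀ i, 0 < k i) (top : ι) :
    ∃ ρ : ℕ → ℝ, (∀ N : ℕ, mean c k (ρ N) = N) ∧ Tendsto ρ atTop atTop := by
  have hcont : Continuous (mean c k) := by unfold mean; fun_prop
  have h0 : mean c k 0 = 0 := by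
    simp [mean, (hk _).ne']
  have hex : ∀ N : ℕ, ∃ r : ℝ, 0 ≤ r ∧ mean c k r = N := by
    intro N
    obtain ⟨R, hR, hR0⟩ := (((tendsto_mean hc hk top).eventually_ge_atTop (N : ℝ)).and
      (eventually_ge_atTop 0)).exists
    obtain ⟨r, hr, h⟩ := intermediate_value_Icc hR0 hcont.continuousOn
      (show (N : ℝ) ∈ Set.Icc (mean c k 0) (mean c k R) from ⟨by rw [h0]; positivity, hR⟩)
    exact ⟨r, hr.1, h⟩
  choose ρ hρ0 hρ using hex
  refine ⟨ρ, hρ, tendsto_atTop.2 fun R => ?_⟩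
  filter_upwards [(tendsto_natCast_atTop_atTop (R := ℝ)).eventually_gt_atTop (mean c k R)]
    with N hN
  by_contra! h
  refine hN.not_ge ?_
  rw [← hρ N]
  refine Finset.sum_le_sum fun i _ => ?_
  have := hc i
  have := hρ0 N
  gcongr

theorem tendsto_ratio_div_saddle {b : ℕ → ℝ}
    (hb : HasFPowerSeriesAt (fun w : ℂ => Complex.exp (∑ i, (c i : ℂ) * w ^ k i))
      (FormalMultilinearSeries.ofScalars ℂ (fun N : ℕ => (b N : ℂ))) 0)
    (hc : ∀ i, 0 < c i) (hk : ∀ i, 0 < k i) (top : ι)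
    (htop : ∀ i, k i ≤ k top) (hap : ∀ ζ : ℂ, (∀ i, ζ ^ k i = 1) → ζ = 1)
    {ρ : ℕ → ℝ} (hρ : ∀ N : ℕ, mean c k (ρ N) = N) (hρt : Tendsto ρ atTop atTop) :
    Tendsto (fun N => b (N - 1) / b N / ρ N) atTop (𝓝 1) := by
  have h0 := (tendsto_integral_exp_cumulant hc hk top htop hap 0).comp hρt
  have h1 := (tendsto_integral_exp_cumulant hc hk top htop hap 1).comp hρt
  have hne : ((√(2 * π) : ℝ) : ℂ) ≠ 0 := by
    have := Real.pi_pos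
    exact_mod_cast (by positivity : √(2 * π) ≠ 0)
  have h := h1.div h0 hne
  rw [div_self hne] at h
  have key : Tendsto (fun N => ((b (N - 1) / b N / ρ N : ℝ) : ℂ)) atTop (𝓝 1) := by
    refine h.congr' ?_
    filter_upwards [eventually_ge_atTop 1, hρt.eventually_gt_atTop 0,
      ((tendsto_stdDev hc hk top).comp hρt).eventually_gt_atTop 0] with N hN hr hs
    -- Both coefficients are evaluated at the same radius `ρ N`, with shifts `0` and `1`.
    have e0 := coeff_mul_stdDev_eq_integral hb hr hs N
    have e1 := coeff_mul_stdDev_eq_integral hb hr hs (N - 1)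
    rw [hρ, sub_self] at e0
    rw [hρ, Nat.cast_sub hN, Nat.cast_one, sub_sub_cancel] at e1
    simp only [Pi.div_apply, Function.comp_apply]
    rw [← e0, ← e1]
    have hr' : (ρ N : ℂ) ≠ 0 := by exact_mod_cast hr.ne'
    have hs' : (stdDev c k (ρ N) : ℂ) ≠ 0 := by
      exact_mod_cast (show 0 < stdDev c k (ρ N) from hs).ne'
    have hp : (π : ℂ) ≠ 0 := by exact_mod_cast Real.pi_ne_zero
    have he := Complex.exp_ne_zero (-((∑ i, c i * ρ N ^ k i : ℝ) : ℂ))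
    rw [mul_div_mul_right _ _ he, mul_div_mul_left _ _ hs',
      mul_div_mul_left _ _ (mul_ne_zero two_ne_zero hp)]
    obtain ⟨M, rfl⟩ := Nat.exists_eq_add_of_le' hN
    simp only [Nat.add_sub_cancel, pow_succ]
    push_cast
    rw [div_div, mul_comm ((ρ (M + 1) : ℂ) ^ M), ← mul_assoc,
      mul_div_mul_right _ _ (pow_ne_zero M hr')]
  simpa only [Function.comp_def, Complex.ofReal_re, Complex.one_re] using
    (Complex.continuous_re.tendsto _).comp key

theorem tendsto_saddle_div (hc : ∀ i, 0 < c i) (hk : ∀ i, 0 < k i) (top : ι)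
    (htop : ∀ i ≠ top, k i < k top)
    {ρ : ℕ → ℝ} (hρ : ∀ N : ℕ, mean c k (ρ N) = N) (hρt : Tendsto ρ atTop atTop) :
    Tendsto (fun N : ℕ => ρ N / ((N : ℝ) / (c top * k top)) ^ (1 / (k top : ℝ))) atTop (𝓝 1) := by
  have hK : (0 : ℝ) < k top := by exact_mod_cast hk top
  have hct := hc top
  have h := ((tendsto_mean_div hc hk top htop).comp hρt).rpow_const (p := 1 / (k top : ℝ))
    (Or.inl one_ne_zero)
  rw [Real.one_rpow] at h
  have h' := h.inv₀ one_ne_zero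
  rw [inv_one] at h'
  refine h'.congr' ?_
  filter_upwards [hρt.eventually_gt_atTop 0] with N hr
  simp only [Function.comp_apply]
  rw [hρ, ← div_div, Real.div_rpow (by positivity) (by positivity), inv_div, one_div,
    Real.pow_rpow_inv_natCast hr.le (hk top).ne']

end ExpPoly

theorem mainTheorem5 (n : ℕ) (hn : 0 < n) (c : Fin n → ℝ) (hc : ∀ i, 0 < c i)
    (k : Fin n → ℕ) (hk_pos : ∀ i, 0 < k i) (hk : StrictMono k) (b : ℕ → ℝ)
    (hb : HasFPowerSeriesAt
      (fun w : ℂ => Complex.exp (∑ i, (c i : ℂ) * w ^ k i))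
      (FormalMultilinearSeries.ofScalars ℂ (fun N : ℕ => (b N : ℂ))) 0)
    (hb_pos : ∀ᶠ N : ℕ in atTop, 0 < b N) :
    (fun N : ℕ => b (N - 1) / b N) ~[atTop]
      (fun N : ℕ =>
        ((N : ℝ) / (c ⟨n - 1, Nat.sub_one_lt_of_lt hn⟩ * (k ⟨n - 1, Nat.sub_one_lt_of_lt hn⟩ : ℝ)))
          ^ (1 / (k ⟨n - 1, Nat.sub_one_lt_of_lt hn⟩ : ℝ))) := by
  set top : Fin n := ⟨n - 1, Nat.sub_one_lt_of_lt hn⟩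
  have hle : ∀ i, i ≤ top := fun i => Fin.le_def.2 (Nat.le_sub_one_of_lt i.2)
  have hK : (0 : ℝ) < k top := by exact_mod_cast hk_pos top
  have hct := hc top
  obtain ⟨ρ, hρ, hρt⟩ := ExpPoly.exists_saddle hc hk_pos top
  have h1 := ExpPoly.tendsto_ratio_div_saddle hb hc hk_pos top (fun i => hk.monotone (hle i))
    (fun ζ => ExpPoly.eq_one_of_forall_pow_eq_one hb hb_pos) hρ hρt
  have h2 := ExpPoly.tendsto_saddle_div hc hk_pos top
    (fun i hi => hk ((hle i).lt_of_ne hi)) hρ hρt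
  have h3 := h1.mul h2
  rw [mul_one] at h3
  refine (isEquivalent_iff_tendsto_one ?_).2 (h3.congr' ?_)
  · filter_upwards [eventually_gt_atTop 0] with N hN
    positivity
  · filter_upwards [hρt.eventually_gt_atTop 0] with N hr
    simp only [Pi.div_apply]
    rw [div_mul_div_cancel₀ hr.ne']
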